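/- Let $\mathbb H=\mathbb H^1$ be the Heisenberg group, i.e. $\mathbb R^3$ with coordinates $(x_1,x_2,t)$, with left-invariant horizontal fields $X_1=\partial_{x_1}+2x_2\partial_t$, $X_2=\partial_{x_2}-2x_1\partial_t$, with the norm $\|\cdot\|_0$ on $\mathrm{span}\{X_1,X_2\}$ for which $X_1,X_2$ are orthonormal, and with Lebesgue measure as Haar measure. Let $N(x_1,x_2,t)=((x_1^2+x_2^2)^2+t^2)^{1/4}$, let $b>1$, and let $R_{1b}=\{g\in\mathbb H: 1\le N(g)\le b\}$. For $\theta\in[0,2\pi)$ and $\alpha\in(-\pi/2,\pi/2)$ let $\varphi_{\theta\alpha}\colon[1,b]\to\mathbb H$ be the radial curve $$\varphi_{\theta\alpha}(r)=\bigl(r\sqrt{\cos\alpha}\,\cos(\theta-\tan\alpha\log r),\; r\sqrt{\cos\alpha}\,\sin(\theta-\tan\alpha\log r),\; r^2\sin\alpha\bigr),$$ and let $\Gamma_0$ be the family of all these (horizontal) curves. For $p>1$ and a family $\Gamma$ of horizontal curves, a Borel function $\rho\colon\mathbb H\to[0,\infty]$ is admissible if $\int_\gamma\rho\,ds\ge 1$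 for all $\gamma\in\Gamma$, where $ds$ is arc length for $\|\cdot\|_0$; the $p$-module is $M_p(\Gamma)=\inf\int_{\mathbb H}\rho^p\,dg$ over all admissible $\rho$, and an admissible $\rho_0$ that attains the infimum is called extremal. **Theorem.** Let $f\colon\mathbb H\to\mathbb H$ be a $C^1$ contact map (its differential maps horizontal planes into horizontal planes) that is orientation preserving (its Jacobian determinant $J_f$ is strictly positive) and injective on $R_{1b}$. Put $c_{\theta\alpha}=f\circ\varphi_{\theta\alpha}$, let $p,q>1$ with $1/p+1/q=1$, and let $$\ell(\theta,\alpha)=\int_1^b\left(\frac{\|\dot c_{\theta\alpha}(r)\|_0}{J_f\,r^3}\right)^{q}J_f\,r^3\,dr,\qquad \theta\in[0,2\pi),\ \alpha\in(-\pi/2,\pi/2),$$ with $J_f$ evaluated at $\varphi_{\theta\alpha}(r)$. Let $\rho_0$ be the function given by $$\rho_0(y)=\frac1{\ell(\theta,\alpha)}\left(\frac{\|\dot c_{\theta\alpha}(r)\|_0}{J_f\,r^3}\right)^{\frac1{p-1}}\quad\text{at } y=f(\varphi_{\theta\alpha}(r)),\ \theta\in[0,2\pi),\ \alpha\in(-\pi/2,\pi/2),\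 r\in[1,b],$$ and by $\rho_0=0$ at all other points. Then $\rho_0$ is extremal for the $p$-module of $f(\Gamma_0)=\{c_{\theta\alpha}\}$, and $$M_p(f(\Gamma_0))=\int_{f(R_{1b})}\rho_0^p\,dy=\int_{-\pi/2}^{\pi/2}\int_0^{2\pi}\ell(\theta,\alpha)^{1-p}\,d\theta\,d\alpha<\infty .$$ -/

import Mathlib

open scoped ENNReal

noncomputable section

/-- The underlying manifold `ℝ³` of the Heisenberg group `ℍ¹`, with coordinates
`(x₁, x₂, t) = (g 0, g 1, g 2)` and the group law
`(x₁, x₂, t) * (y₁, y₂, s) = (x₁ + y₁, x₂ + y₂, t + s + 2 * (x₂ * y₁ - x₁ * y₂))`.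
Its Haar measure is the Lebesgue measure `volume`. -/
abbrev Heis : Type := Fin 3 → ℝ

namespace Heis

/-- The left-invariant horizontal field `X₁ = ∂/∂x₁ + 2 x₂ ∂/∂t`. -/
def X₁ (g : Heis) : Heis := ![1, 0, 2 * g 1]

/-- The left-invariant horizontal field `X₂ = ∂/∂x₂ - 2 x₁ ∂/∂t`. -/
def X₂ (g : Heis) : Heis := ![0, 1, -2 * g 0]

/-- The horizontal plane at `g`, spanned by `X₁ g` and `X₂ g`. -/
def horizontalPlane (g : Heis) : Submodule ℝ Heis := Submodule.span ℝ {X₁ g, X₂ g}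

/-- The sub-Riemannian norm of a horizontal vector, for the inner product that makes `X₁, X₂`
orthonormal. A horizontal `v` at `g` equals `v 0 • X₁ g + v 1 • X₂ g`, whatever `g` is; the value
is meaningful for horizontal vectors only. -/
def horizontalNorm (v : Heis) : ℝ := Real.sqrt (v 0 ^ 2 + v 1 ^ 2)

theorem eq_of_mem_horizontalPlane {g v : Heis} (hv : v ∈ horizontalPlane g) :
    v = v 0 • X₁ g + v 1 • X₂ g := by
  obtain ⟨a, c, rfl⟩ := Submodule.mem_span_pair.1 hv
  ext i
  fin_cases i <;> simp [X₁, X₂]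

/-- The differential of `f` maps horizontal planes into horizontal planes. -/
def IsContact (f : Heis → Heis) : Prop :=
  ∀ g : Heis, ∀ v ∈ horizontalPlane g, fderiv ℝ f g v ∈ horizontalPlane (f g)

/-- The Jacobian determinant of `f` at `g`. -/
def jacobian (f : Heis → Heis) (g : Heis) : ℝ := (fderiv ℝ f g).det

/-- The homogeneous (Korányi) norm. -/
def homNorm (g : Heis) : ℝ := ((g 0 ^ 2 + g 1 ^ 2) ^ 2 + g 2 ^ 2) ^ (1 / 4 : ℝ)

/-- The spherical ring `R_{1b}`. -/
def sphericalRing (b : ℝ) : Set Heis := {g | 1 ≤ homNorm g ∧ homNorm g ≤ b}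

/-- The radial curve `φ_{θα}`, as a function of `r > 0`. -/
def radialCurve (θ α r : ℝ) : Heis :=
  ![r * Real.sqrt (Real.cos α) * Real.cos (θ - Real.tan α * Real.log r),
    r * Real.sqrt (Real.cos α) * Real.sin (θ - Real.tan α * Real.log r),
    r ^ 2 * Real.sin α]

/-- The family `Γ₀` of all radial curves; they are considered on the parameter interval
`[1, b]`. -/
def radialFamily : Set (ℝ → Heis) :=
  {c | ∃ θ ∈ Set.Ico 0 (2 * Real.pi), ∃ α ∈ Set.Ioo (-(Real.pi / 2)) (Real.pi / 2),
    c = radialCurve θ α}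

/-- The image `f(Γ)` of a family of curves. -/
def imageFamily (f : Heis → Heis) (Γ : Set (ℝ → Heis)) : Set (ℝ → Heis) :=
  (fun c r => f (c r)) '' Γ

/-- The integral of `ρ` over the horizontal curve `c : [a, b] → ℍ¹` with respect to the
sub-Riemannian arc length. -/
def arcIntegral (a b : ℝ) (ρ : Heis → ℝ≥0∞) (c : ℝ → Heis) : ℝ≥0∞ :=
  ∫⁻ r in Set.Icc a b, ρ (c r) * ENNReal.ofReal (horizontalNorm (deriv c r))

/-- `ρ` is admissible for the family `Γ` of horizontal curves `[a, b] → ℍ¹`. -/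
def IsAdmissible (a b : ℝ) (Γ : Set (ℝ → Heis)) (ρ : Heis → ℝ≥0∞) : Prop :=
  Measurable ρ ∧ ∀ c ∈ Γ, 1 ≤ arcIntegral a b ρ c

/-- The `p`-module of the family `Γ` of horizontal curves `[a, b] → ℍ¹`. -/
def pModule (a b p : ℝ) (Γ : Set (ℝ → Heis)) : ℝ≥0∞ :=
  ⨅ (ρ : Heis → ℝ≥0∞) (_ : IsAdmissible a b Γ ρ), ∫⁻ y, ρ y ^ p

/-- `ρ₀` is an extremal function for the `p`-module of `Γ`. -/
def IsExtremal (a b p : ℝ) (Γ : Set (ℝ → Heis)) (ρ₀ : Heis → ℝ≥0∞) : Prop :=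
  IsAdmissible a b Γ ρ₀ ∧ pModule a b p Γ = ∫⁻ y, ρ₀ y ^ p

/-- The speed `‖ċ_{θα}(r)‖₀` of the image curve `c_{θα} = f ∘ φ_{θα}`. -/
def imageSpeed (f : Heis → Heis) (θ α r : ℝ) : ℝ :=
  horizontalNorm (deriv (fun s => f (radialCurve θ α s)) r)

/-- The volume density `J_f r³` of `f ∘ φ` in the coordinates `(θ, α, r)`, where `J_f` is evaluated
at `φ_{θα}(r)`. -/
def imageDensity (f : Heis → Heis) (θ α r : ℝ) : ℝ :=
  jacobian f (radialCurve θ α r) * r ^ 3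

/-- The function `ℓ(θ, α)`. -/
def ell (f : Heis → Heis) (b q θ α : ℝ) : ℝ :=
  ∫ r in (1 : ℝ)..b, (imageSpeed f θ α r / imageDensity f θ α r) ^ q * imageDensity f θ α r

/-- The set of the polar coordinates `(θ, α, r)` of the ring (without the `t`-axis). -/
def polarDomain (b : ℝ) : Set (ℝ × ℝ × ℝ) :=
  Set.Ico 0 (2 * Real.pi) ×ˢ Set.Ioo (-(Real.pi / 2)) (Real.pi / 2) ×ˢ Set.Icc 1 b

/-- The function `ρ₀`: at `y = f(φ_{θα}(r))` with `(θ, α, r)` in `polarDomain b` it is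
`ℓ(θ, α)⁻¹ (‖ċ_{θα}(r)‖₀ / (J_f r³)) ^ (1 / (p - 1))`; it vanishes at all other points. -/
def extremalFunction (f : Heis → Heis) (b p q : ℝ) : Heis → ℝ≥0∞ :=
  Function.extend (fun z : polarDomain b => f (radialCurve z.1.1 z.1.2.1 z.1.2.2))
    (fun z : polarDomain b => ENNReal.ofReal ((ell f b q z.1.1 z.1.2.1)⁻¹ *
      (imageSpeed f z.1.1 z.1.2.1 z.1.2.2 / imageDensity f z.1.1 z.1.2.1 z.1.2.2)
        ^ (1 / (p - 1))))
    0

end Heis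

end

/-! The radial curves foliate their union, and in the coordinates (θ, α, r) Lebesgue measure is r³
dr dθ dα (`det_polarDeriv`). As `f` is injective, an integral over the image is an iterated integral
with density D = J_f r³ (`lintegral_image_polarBox`), and the problem splits into one on each curve.

Put w = ‖ċ‖₀ / D. For admissible ρ, Hölder's inequality with respect to D dr gives 1 ≤ ∫ ρ w D dr ≤
(∫ ρ^p D dr)^(1/p) ℓ^(1/q), hence ∫ ρ^p D dr ≥ ℓ^(1-p) (`ofReal_ell_rpow_le`). Equality requires ρ^p
proportional to w^q, so ρ is a multiple of w^(1/(p-1)); the factor 1/ℓ makes the length of each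
curve exactly 1 (`arcIntegral_extremalFunction`, `lintegral_radialCurve_extremalFunction`).

Finiteness needs ℓ bounded away from 0 (`exists_le_ell`): a contact map with positive Jacobian kills
no horizontal vector, and compactness makes this uniform. -/

open MeasureTheory

namespace Heis

/-! ### Radial curves and the horizontal norm -/

/-- The velocity vector of the radial curve `φ_{θα}`. -/
noncomputable def radialVelocity (θ α r : ℝ) : Heis :=
  ![√(Real.cos α) * Real.cos (θ - Real.tan α * Real.log r)
      + √(Real.cos α) * Real.tan α * Real.sin (θ - Real.tan α * Real.log r),
    √(Real.cos α) * Real.sin (θ - Real.tan α * Real.log r)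
      - √(Real.cos α) * Real.tan α * Real.cos (θ - Real.tan α * Real.log r),
    2 * r * Real.sin α]

theorem hasDerivAt_radialCurve (θ α : ℝ) {r : ℝ} (hr : r ≠ 0) :
    HasDerivAt (radialCurve θ α) (radialVelocity θ α r) r := by
  have hψ : HasDerivAt (fun s => θ - Real.tan α * Real.log s) (-(Real.tan α * r⁻¹)) r := by
    simpa using ((Real.hasDerivAt_log hr).const_mul (Real.tan α)).const_sub θ
  have hl : HasDerivAt (fun s : ℝ => s * √(Real.cos α)) (√(Real.cos α)) r := by
    simpa using (hasDerivAt_id r).mul_const (√(Real.cos α))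
  refine hasDerivAt_pi.2 fun i => ?_
  fin_cases i
  · refine (hl.mul hψ.cos).congr_deriv ?_
    simp [radialVelocity]
    field_simp
  · refine (hl.mul hψ.sin).congr_deriv ?_
    simp [radialVelocity]
    field_simp
    ring
  · refine ((hasDerivAt_pow 2 r).mul_const (Real.sin α)).congr_deriv ?_
    simp [radialVelocity]

/-- The horizontal plane is the kernel of the contact form dt - 2 x₂ dx₁ + 2 x₁ dx₂. -/
theorem mem_horizontalPlane_iff {g v : Heis} :
    v ∈ horizontalPlane g ↔ v 2 = 2 * (g 1 * v 0 - g 0 * v 1) := by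
  constructor
  · intro h
    have := congrFun (eq_of_mem_horizontalPlane h) 2
    simp [X₁, X₂] at this
    rw [this]; ring
  · intro h
    refine Submodule.mem_span_pair.2 ⟨v 0, v 1, ?_⟩
    ext i
    fin_cases i <;> simp [X₁, X₂]
    rw [h]; ring

theorem radialVelocity_mem_horizontalPlane (θ r : ℝ) {α : ℝ} (hα : 0 < Real.cos α) :
    radialVelocity θ α r ∈ horizontalPlane (radialCurve θ α r) := by
  rw [mem_horizontalPlane_iff]
  simp only [radialVelocity, radialCurve, Matrix.cons_val]
  set ψ := θ - Real.tan α * Real.log r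
  have hk := Real.sq_sqrt hα.le
  have ht := Real.tan_mul_cos hα.ne'
  have hs := Real.sin_sq_add_cos_sq ψ
  linear_combination (-2 * r) * ht - 2 * r * Real.tan α * hk
    - 2 * r * Real.tan α * √(Real.cos α) ^ 2 * hs

theorem sq_add_sq_radialVelocity (θ r : ℝ) {α : ℝ} (hα : 0 < Real.cos α) :
    radialVelocity θ α r 0 ^ 2 + radialVelocity θ α r 1 ^ 2 = (Real.cos α)⁻¹ := by
  simp only [radialVelocity, Matrix.cons_val]
  set ψ := θ - Real.tan α * Real.log r
  have hk := Real.sq_sqrt hα.le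
  have ht : 1 + Real.tan α ^ 2 = (Real.cos α ^ 2)⁻¹ := by
    rw [← Real.inv_one_add_tan_sq hα.ne', inv_inv]
  have hs := Real.sin_sq_add_cos_sq ψ
  have : (Real.cos α)⁻¹ = Real.cos α * (1 + Real.tan α ^ 2) := by
    rw [ht]; field_simp
  rw [this]
  linear_combination (1 + Real.tan α ^ 2) * hk + √(Real.cos α) ^ 2 * (1 + Real.tan α ^ 2) * hs

theorem horizontalNorm_eq_zero_iff {g v : Heis} (hv : v ∈ horizontalPlane g) :
    horizontalNorm v = 0 ↔ v = 0 := by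
  constructor
  · intro h
    have h0 : v 0 ^ 2 + v 1 ^ 2 = 0 := (Real.sqrt_eq_zero (by positivity)).1 h
    have h1 : v 0 = 0 := by nlinarith [sq_nonneg (v 0), sq_nonneg (v 1)]
    have h2 : v 1 = 0 := by nlinarith [sq_nonneg (v 0), sq_nonneg (v 1)]
    rw [eq_of_mem_horizontalPlane hv, h1, h2]; simp
  · rintro rfl; simp [horizontalNorm]

theorem horizontalNorm_nonneg (v : Heis) : 0 ≤ horizontalNorm v := Real.sqrt_nonneg _

theorem continuous_horizontalNorm : Continuous horizontalNorm := by
  unfold horizontalNorm; fun_prop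

theorem horizontalNorm_smul (c : ℝ) (v : Heis) :
    horizontalNorm (c • v) = |c| * horizontalNorm v := by
  rw [horizontalNorm, horizontalNorm, ← Real.sqrt_sq_eq_abs, ← Real.sqrt_mul (sq_nonneg c)]
  congr 1
  simp; ring

theorem homNorm_radialCurve (θ : ℝ) {α r : ℝ} (hα : 0 < Real.cos α) (hr : 0 ≤ r) :
    homNorm (radialCurve θ α r) = r := by
  have hk := Real.sq_sqrt hα.le
  have : ((radialCurve θ α r 0 ^ 2 + radialCurve θ α r 1 ^ 2) ^ 2 + radialCurve θ α r 2 ^ 2)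
      = r ^ (4 : ℝ) := by
    simp only [radialCurve, Matrix.cons_val]
    set ψ := θ - Real.tan α * Real.log r
    have h1 : (r * √(Real.cos α) * Real.cos ψ) ^ 2 + (r * √(Real.cos α) * Real.sin ψ) ^ 2
        = r ^ 2 * Real.cos α := by
      linear_combination r ^ 2 * hk + r ^ 2 * √(Real.cos α) ^ 2 * Real.sin_sq_add_cos_sq ψ
    rw [h1]
    norm_cast
    linear_combination r ^ 4 * Real.sin_sq_add_cos_sq α
  rw [homNorm, this, ← Real.rpow_mul hr]
  norm_num

/-! ### Polar coordinates and their Jacobian -/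

/-- The polar coordinate map `(θ, α, r) ↦ φ_{θα}(r)`. -/
noncomputable def polarMap (z : Heis) : Heis := radialCurve (z 0) (z 1) (z 2)

/-- The polar domain as a subset of `ℝ³`. -/
def polarBox (b : ℝ) : Set Heis :=
  Set.univ.pi ![Set.Ico 0 (2 * Real.pi), Set.Ioo (-(Real.pi / 2)) (Real.pi / 2), Set.Icc 1 b]

theorem mem_polarBox {b : ℝ} {z : Heis} : z ∈ polarBox b ↔
    z 0 ∈ Set.Ico 0 (2 * Real.pi) ∧ z 1 ∈ Set.Ioo (-(Real.pi / 2)) (Real.pi / 2) ∧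
      z 2 ∈ Set.Icc 1 b := by
  simp only [polarBox, Set.mem_univ_pi, Fin.forall_fin_succ]
  simp

theorem measurableSet_polarBox (b : ℝ) : MeasurableSet (polarBox b) := by
  refine MeasurableSet.univ_pi fun i => ?_
  fin_cases i
  · exact measurableSet_Ico
  · exact measurableSet_Ioo
  · exact measurableSet_Icc

theorem measurable_polarMap : Measurable polarMap := by
  refine measurable_pi_iff.2 fun i => ?_
  fin_cases i <;> simp [polarMap, radialCurve, Real.tan_eq_sin_div_cos] <;> fun_prop

theorem polarMap_mem_sphericalRing {b : ℝ} {z : Heis} (hz : z ∈ polarBox b) :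
    polarMap z ∈ sphericalRing b := by
  obtain ⟨-, h1, h2⟩ := mem_polarBox.1 hz
  have := homNorm_radialCurve (z 0) (Real.cos_pos_of_mem_Ioo h1) (zero_le_one.trans h2.1)
  rw [sphericalRing, Set.mem_ofPred_eq, polarMap, this]
  exact h2

/-- The homogeneous norm recovers r, the t-coordinate then gives α, and the first two coordinates
give θ. -/
theorem injOn_polarMap (b : ℝ) : Set.InjOn polarMap (polarBox b) := by
  intro z hz w hw h
  obtain ⟨hz0, hz1, hz2⟩ := mem_polarBox.1 hz
  obtain ⟨hw0, hw1, hw2⟩ := mem_polarBox.1 hw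
  have cz := Real.cos_pos_of_mem_Ioo hz1
  have cw := Real.cos_pos_of_mem_Ioo hw1
  have e2 : z 2 = w 2 := by
    rw [← homNorm_radialCurve (z 0) cz (zero_le_one.trans hz2.1),
      ← homNorm_radialCurve (w 0) cw (zero_le_one.trans hw2.1)]
    exact congrArg homNorm h
  have hr : 0 < w 2 := zero_lt_one.trans_le hw2.1
  have e1 : z 1 = w 1 := by
    have := congrFun h 2
    simp only [polarMap, radialCurve, Matrix.cons_val, e2] at this
    exact Real.injOn_sin (Set.Ioo_subset_Icc_self hz1) (Set.Ioo_subset_Icc_self hw1)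
      (mul_left_cancel₀ (by positivity) this)
  have hrk : w 2 * √(Real.cos (w 1)) ≠ 0 := by positivity
  have hc := congrFun h 0
  have hs := congrFun h 1
  simp only [polarMap, radialCurve, Matrix.cons_val, e1, e2] at hc hs
  replace hc := mul_left_cancel₀ hrk hc
  replace hs := mul_left_cancel₀ hrk hs
  set τ := Real.tan (w 1) * Real.log (w 2)
  have e0 : z 0 = w 0 := by
    -- Both angles lie in [0, 2π), so their difference lies in (-2π, 2π), where the cosine is 1 only
    -- at 0.
    have h1 : Real.cos (z 0 - w 0) = 1 := by
      have : z 0 - w 0 = (z 0 - τ) - (w 0 - τ) := by ring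
      rw [this, Real.cos_sub, hc, hs, ← Real.sin_sq_add_cos_sq (w 0 - τ)]; ring
    have := (Real.cos_eq_one_iff_of_lt_of_lt (by linarith [hz0.1, hw0.2]) (by linarith [hz0.2, hw0.1])).1 h1
    linarith
  ext i
  fin_cases i
  exacts [e0, e1, e2]

/-- The Jacobian matrix of the polar coordinate map. -/
noncomputable def polarMatrix (z : Heis) : Matrix (Fin 3) (Fin 3) ℝ :=
  let k := √(Real.cos (z 1))
  let ψ := z 0 - Real.tan (z 1) * Real.log (z 2)
  let k' := -Real.sin (z 1) / (2 * k)
  let ψ' := -(1 / Real.cos (z 1) ^ 2 * Real.log (z 2))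
  !![-(z 2 * k * Real.sin ψ), z 2 * k' * Real.cos ψ - z 2 * k * Real.sin ψ * ψ',
      radialVelocity (z 0) (z 1) (z 2) 0;
    z 2 * k * Real.cos ψ, z 2 * k' * Real.sin ψ + z 2 * k * Real.cos ψ * ψ',
      radialVelocity (z 0) (z 1) (z 2) 1;
    0, z 2 ^ 2 * Real.cos (z 1), radialVelocity (z 0) (z 1) (z 2) 2]

/-- The differential of the polar coordinate map. -/
noncomputable def polarDeriv (z : Heis) : Heis →L[ℝ] Heis :=
  LinearMap.toContinuousLinearMap (Matrix.toLin' (polarMatrix z))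

theorem hasFDerivAt_polarMap {z : Heis} (h1 : 0 < Real.cos (z 1)) (h2 : z 2 ≠ 0) :
    HasFDerivAt polarMap (polarDeriv z) z := by
  have p (i : Fin 3) : HasFDerivAt (fun z : Heis => z i)
      (ContinuousLinearMap.proj (R := ℝ) (φ := fun _ : Fin 3 => ℝ) i) z :=
    (ContinuousLinearMap.proj (R := ℝ) (φ := fun _ : Fin 3 => ℝ) i).hasFDerivAt
  have hk := (p 1).cos.sqrt h1.ne'
  have ht := (Real.hasDerivAt_tan h1.ne').comp_hasFDerivAt z (p 1)
  have hψ := (p 0).sub (ht.mul ((p 2).log h2))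
  refine hasFDerivAt_pi'.2 fun i => ?_
  fin_cases i
  · refine (((p 2).mul hk).mul hψ.cos).congr_fderiv ?_
    ext v
    simp [polarDeriv, polarMatrix, radialVelocity, Matrix.toLin'_apply, dotProduct,
      Fin.sum_univ_three]
    field_simp
    ring
  · refine (((p 2).mul hk).mul hψ.sin).congr_fderiv ?_
    ext v
    simp [polarDeriv, polarMatrix, radialVelocity, Matrix.toLin'_apply, dotProduct,
      Fin.sum_univ_three]
    field_simp
    ring
  · refine (((p 2).pow 2).mul (p 1).sin).congr_fderiv ?_
    ext v
    simp [polarDeriv, polarMatrix, radialVelocity, Matrix.toLin'_apply, dotProduct,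
      Fin.sum_univ_three]
    ring

theorem det_polarDeriv {z : Heis} (h1 : 0 < Real.cos (z 1)) :
    (polarDeriv z).det = z 2 ^ 3 := by
  have hk := Real.sq_sqrt h1.le
  have hk0 : √(Real.cos (z 1)) ≠ 0 := by positivity
  have ht := Real.tan_mul_cos h1.ne'
  have : (polarDeriv z).det = (polarMatrix z).det := by
    rw [polarDeriv, LinearMap.det_toContinuousLinearMap, LinearMap.det_toLin']
  rw [this, Matrix.det_fin_three]
  simp [polarMatrix, radialVelocity]
  set ψ := z 0 - Real.tan (z 1) * Real.log (z 2)
  set k := √(Real.cos (z 1))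
  set T := Real.tan (z 1)
  set S := Real.sin (z 1)
  set C := Real.cos (z 1)
  have hs := Real.sin_sq_add_cos_sq ψ
  have hs' : S ^ 2 + C ^ 2 = 1 := Real.sin_sq_add_cos_sq (z 1)
  -- With cos α = k² and sin α = T k², the claim becomes algebraic in k, T, r, sin ψ and cos ψ,
  -- modulo the two Pythagorean relations.
  have hS : S = T * k ^ 2 := by rw [hk, ht]
  rw [← hk] at hs' ⊢
  clear_value k ψ T S C
  rw [hS] at hs' ⊢
  field_simp
  linear_combination z 2 ^ 3 * hs' + z 2 ^ 3 * k ^ 4 * (1 + T ^ 2) * hs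

/-- Splitting off the middle coordinate first makes α the outermost variable, then θ, then r, as in
the final formula. -/
theorem lintegral_pi_fin_three (μ : Fin 3 → Measure ℝ) [∀ i, SigmaFinite (μ i)]
    {H : (Fin 3 → ℝ) → ℝ≥0∞} (hH : Measurable H) :
    ∫⁻ z, H z ∂Measure.pi μ = ∫⁻ y, ∫⁻ x, ∫⁻ w, H ![x, y, w] ∂μ 2 ∂μ 0 ∂μ 1 := by
  have e1 := (measurePreserving_piFinSuccAbove μ 1).symm
  have e2 := (measurePreserving_piFinTwo fun j => μ (Fin.succAbove 1 j)).symm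
  rw [← e1.lintegral_comp hH, lintegral_prod _ (by fun_prop)]
  refine lintegral_congr fun y => ?_
  have hy : Measurable fun u : Fin 2 → ℝ =>
      H ((MeasurableEquiv.piFinSuccAbove (fun _ : Fin 3 => ℝ) 1).symm (y, u)) :=
    hH.comp ((MeasurableEquiv.measurable _).comp measurable_prodMk_left)
  refine (e2.lintegral_comp hy).symm.trans ?_
  rw [lintegral_prod _ (by fun_prop)]
  refine lintegral_congr fun x => lintegral_congr fun w => ?_
  congr 1
  ext i
  fin_cases i <;> rfl

theorem lintegral_polarBox {b : ℝ} {H : Heis → ℝ≥0∞} (hH : Measurable H) :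
    ∫⁻ z in polarBox b, H z = ∫⁻ α in Set.Ioo (-(Real.pi / 2)) (Real.pi / 2),
      ∫⁻ θ in Set.Ico 0 (2 * Real.pi), ∫⁻ r in Set.Icc 1 b, H ![θ, α, r] := by
  rw [polarBox, volume_pi, Measure.restrict_pi_pi, lintegral_pi_fin_three _ hH]
  rfl

theorem measurable_radialCurve (θ α : ℝ) : Measurable (radialCurve θ α) := by
  have : Measurable fun r : ℝ => (![θ, α, r] : Heis) := by
    refine measurable_pi_iff.2 fun i => ?_
    fin_cases i <;> simp <;> fun_prop
  exact measurable_polarMap.comp this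

/-! ### Speed and density along the image curves -/

section

variable {f : Heis → Heis}

theorem continuous_jacobian (hf : ContDiff ℝ 1 f) : Continuous (jacobian f) :=
  ContinuousLinearMap.continuous_det.comp (hf.continuous_fderiv one_ne_zero)

theorem measurable_imageDensity (hf : ContDiff ℝ 1 f) (θ α : ℝ) :
    Measurable (imageDensity f θ α) :=
  ((continuous_jacobian hf).measurable.comp (measurable_radialCurve θ α)).mul
    (measurable_id.pow_const 3)

theorem measurable_imageSpeed (f : Heis → Heis) (θ α : ℝ) : Measurable (imageSpeed f θ α) :=
  continuous_horizontalNorm.measurable.comp (measurable_deriv _)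

theorem imageDensity_pos (hJ : ∀ g, 0 < jacobian f g) (θ α : ℝ) {r : ℝ} (hr : 0 < r) :
    0 < imageDensity f θ α r :=
  mul_pos (hJ _) (by positivity)

theorem imageSpeed_eq (hf : ContDiff ℝ 1 f) (θ α : ℝ) {r : ℝ} (hr : r ≠ 0) :
    imageSpeed f θ α r =
      horizontalNorm (fderiv ℝ f (radialCurve θ α r) (radialVelocity θ α r)) := by
  have h := (hf.differentiable one_ne_zero (radialCurve θ α r)).hasFDerivAt.comp_hasDerivAt r
    (hasDerivAt_radialCurve θ α hr)
  exact congrArg horizontalNorm h.deriv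

/-- The differential is injective, and the contact condition keeps the image horizontal, where
`horizontalNorm` vanishes only at 0. -/
theorem horizontalNorm_fderiv_pos (hcontact : IsContact f) (hJ : ∀ g, 0 < jacobian f g)
    {g v : Heis} (hv : v ∈ horizontalPlane g) (hv0 : v ≠ 0) :
    0 < horizontalNorm (fderiv ℝ f g v) := by
  refine (horizontalNorm_nonneg _).lt_of_ne' fun h => hv0 ?_
  have h0 := (horizontalNorm_eq_zero_iff (hcontact g v hv)).1 h
  exact (LinearMap.equivOfDetNeZero (fderiv ℝ f g : Heis →ₗ[ℝ] Heis) (hJ g).ne').injective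
    (h0.trans (map_zero _).symm)

theorem imageSpeed_nonneg (f : Heis → Heis) (θ α r : ℝ) : 0 ≤ imageSpeed f θ α r :=
  horizontalNorm_nonneg _

theorem hasFDerivAt_comp_polarMap (hf : ContDiff ℝ 1 f) {b : ℝ} {z : Heis}
    (hz : z ∈ polarBox b) :
    HasFDerivAt (fun z => f (polarMap z)) ((fderiv ℝ f (polarMap z)).comp (polarDeriv z)) z := by
  obtain ⟨-, h1, h2⟩ := mem_polarBox.1 hz
  exact (hf.differentiable one_ne_zero (polarMap z)).hasFDerivAt.comp z
    (hasFDerivAt_polarMap (Real.cos_pos_of_mem_Ioo h1) (zero_lt_one.trans_le h2.1).ne')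

theorem injOn_comp_polarMap {b : ℝ} (hinj : Set.InjOn f (sphericalRing b)) :
    Set.InjOn (fun z => f (polarMap z)) (polarBox b) :=
  hinj.comp (injOn_polarMap b) fun _ hz => polarMap_mem_sphericalRing hz

theorem measurable_comp_polarMap (hf : ContDiff ℝ 1 f) : Measurable fun z => f (polarMap z) :=
  hf.continuous.measurable.comp measurable_polarMap

/-! ### Change of variables and Hölder's inequality -/

/-- Integration in polar coordinates over the image of the ring. -/
theorem lintegral_image_polarBox (hf : ContDiff ℝ 1 f) (hJ : ∀ g, 0 < jacobian f g) {b : ℝ}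
    (hinj : Set.InjOn f (sphericalRing b)) {G : Heis → ℝ≥0∞} (hG : Measurable G) :
    ∫⁻ y in (fun z => f (polarMap z)) '' polarBox b, G y =
      ∫⁻ α in Set.Ioo (-(Real.pi / 2)) (Real.pi / 2), ∫⁻ θ in Set.Ico 0 (2 * Real.pi),
        ∫⁻ r in Set.Icc 1 b, G (f (radialCurve θ α r)) * ENNReal.ofReal (imageDensity f θ α r) := by
  rw [lintegral_image_eq_lintegral_abs_det_fderiv_mul volume (measurableSet_polarBox b)
    (fun z hz => (hasFDerivAt_comp_polarMap hf hz).hasFDerivWithinAt) (injOn_comp_polarMap hinj)]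
  have : ∫⁻ z in polarBox b, ENNReal.ofReal
      |((fderiv ℝ f (polarMap z)).comp (polarDeriv z)).det| * G (f (polarMap z)) =
      ∫⁻ z in polarBox b, G (f (polarMap z)) *
        ENNReal.ofReal (jacobian f (polarMap z) * z 2 ^ 3) := by
    refine setLIntegral_congr_fun (measurableSet_polarBox b) fun z hz => ?_
    obtain ⟨-, h1, h2⟩ := mem_polarBox.1 hz
    have hr : 0 < z 2 := zero_lt_one.trans_le h2.1
    have hdet : ((fderiv ℝ f (polarMap z)).comp (polarDeriv z)).det =
        jacobian f (polarMap z) * z 2 ^ 3 := by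
      rw [← det_polarDeriv (Real.cos_pos_of_mem_Ioo h1)]
      exact LinearMap.det_comp _ _
    rw [hdet, abs_of_pos (mul_pos (hJ _) (by positivity)), mul_comm]
  rw [this, lintegral_polarBox]
  · rfl
  · exact (hG.comp (measurable_comp_polarMap hf)).mul
      (((continuous_jacobian hf).measurable.comp measurable_polarMap).mul
        ((measurable_pi_apply 2).pow_const 3)).ennreal_ofReal

/-- A weighted Hölder inequality. -/
theorem one_le_of_one_le_lintegral_mul {μ : Measure ℝ} {p q : ℝ} (h : p.HolderConjugate q)
    {u w d : ℝ → ℝ≥0∞} (hu : Measurable u) (hw : Measurable w) (hd : Measurable d)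
    (h1 : 1 ≤ ∫⁻ r, u r * w r * d r ∂μ) :
    1 ≤ (∫⁻ r, u r ^ p * d r ∂μ) * (∫⁻ r, w r ^ q * d r ∂μ) ^ (p - 1) := by
  -- The weight `d` is absorbed into the measure; raising to the power p then leaves the exponent
  -- p/q = p - 1 on the second factor.
  have key := ENNReal.lintegral_mul_le_Lp_mul_Lq (μ.withDensity d) h hu.aemeasurable
    hw.aemeasurable
  rw [lintegral_withDensity_eq_lintegral_mul _ hd (hu.mul hw),
    lintegral_withDensity_eq_lintegral_mul _ hd (hu.pow_const p),
    lintegral_withDensity_eq_lintegral_mul _ hd (hw.pow_const q)] at key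
  simp only [Pi.mul_apply, mul_comm (d _)] at key
  have h2 := ENNReal.rpow_le_rpow (h1.trans key) h.nonneg
  rw [ENNReal.one_rpow, ENNReal.mul_rpow_of_nonneg _ _ h.nonneg, ← ENNReal.rpow_mul,
    ← ENNReal.rpow_mul, one_div_mul_cancel h.ne_zero, ENNReal.rpow_one] at h2
  convert h2 using 3
  have := h.inv_add_inv_eq_one
  have h0 := h.ne_zero
  rw [one_div, eq_sub_iff_add_eq'.2 this]
  field_simp

/-! ### Positive lower bound for ℓ -/

theorem continuousOn_imageSpeed (hf : ContDiff ℝ 1 f) (b θ α : ℝ) :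
    ContinuousOn (imageSpeed f θ α) (Set.Icc 1 b) := by
  have hne : ∀ r ∈ Set.Icc 1 b, r ≠ 0 := fun r hr => (zero_lt_one.trans_le hr.1).ne'
  have hc : ContinuousOn (radialCurve θ α) (Set.Icc 1 b) := fun r hr =>
    (hasDerivAt_radialCurve θ α (hne r hr)).continuousAt.continuousWithinAt
  have hl : ContinuousOn Real.log (Set.Icc 1 b) :=
    Real.continuousOn_log.mono fun r hr => hne r hr
  have hv : ContinuousOn (radialVelocity θ α) (Set.Icc 1 b) := by
    refine continuousOn_pi.2 fun i => ?_
    fin_cases i <;> simp [radialVelocity] <;> fun_prop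
  exact (continuous_horizontalNorm.comp_continuousOn
    ((hf.continuous_fderiv_apply one_ne_zero).comp_continuousOn (hc.prodMk hv))).congr
      fun r hr => imageSpeed_eq hf θ α (hne r hr)

theorem continuousOn_imageDensity (hf : ContDiff ℝ 1 f) (b θ α : ℝ) :
    ContinuousOn (imageDensity f θ α) (Set.Icc 1 b) := by
  have hc : ContinuousOn (radialCurve θ α) (Set.Icc 1 b) := fun r hr =>
    (hasDerivAt_radialCurve θ α (zero_lt_one.trans_le hr.1).ne').continuousAt.continuousWithinAt
  exact ((continuous_jacobian hf).comp_continuousOn hc).mul (by fun_prop)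

theorem continuousOn_ell_integrand (hf : ContDiff ℝ 1 f) (hJ : ∀ g, 0 < jacobian f g)
    {q : ℝ} (hq : 0 ≤ q) (b θ α : ℝ) :
    ContinuousOn (fun r => (imageSpeed f θ α r / imageDensity f θ α r) ^ q * imageDensity f θ α r)
      (Set.Icc 1 b) :=
  (((continuousOn_imageSpeed hf b θ α).div (continuousOn_imageDensity hf b θ α) fun _ hr =>
    (imageDensity_pos hJ θ α (zero_lt_one.trans_le hr.1)).ne').rpow_const
      fun _ _ => Or.inr hq).mul (continuousOn_imageDensity hf b θ α)

theorem ofReal_ell (hf : ContDiff ℝ 1 f) (hJ : ∀ g, 0 < jacobian f g)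
    {b q : ℝ} (hb : 1 ≤ b) (hq : 0 ≤ q) (θ α : ℝ) :
    ENNReal.ofReal (ell f b q θ α) = ∫⁻ r in Set.Icc 1 b,
      ENNReal.ofReal (imageSpeed f θ α r / imageDensity f θ α r) ^ q *
        ENNReal.ofReal (imageDensity f θ α r) := by
  have hw : ∀ r ∈ Set.Icc 1 b, 0 < imageDensity f θ α r := fun r hr =>
    imageDensity_pos hJ θ α (zero_lt_one.trans_le hr.1)
  rw [ell, intervalIntegral.integral_of_le hb, ← integral_Icc_eq_integral_Ioc,
    ofReal_integral_eq_lintegral_ofReal]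
  · refine setLIntegral_congr_fun measurableSet_Icc fun r hr => ?_
    have := div_nonneg (imageSpeed_nonneg f θ α r) (hw r hr).le
    rw [ENNReal.ofReal_mul (by positivity), ENNReal.ofReal_rpow_of_nonneg this hq]
  · exact (continuousOn_ell_integrand hf hJ hq b θ α).integrableOn_Icc
  · refine (ae_restrict_iff' measurableSet_Icc).2 (ae_of_all _ fun r hr => ?_)
    have := div_nonneg (imageSpeed_nonneg f θ α r) (hw r hr).le
    exact mul_nonneg (by positivity) (hw r hr).le

/-- A contact map with non-vanishing Jacobian expands horizontal vectors over a compact set by at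
least a fixed factor. -/
theorem exists_mul_horizontalNorm_le (hf : ContDiff ℝ 1 f) (hcontact : IsContact f)
    (hJ : ∀ g, 0 < jacobian f g) {K : Set Heis} (hK : IsCompact K) (hK0 : K.Nonempty) :
    ∃ m > 0, ∀ g ∈ K, ∀ v ∈ horizontalPlane g,
      m * horizontalNorm v ≤ horizontalNorm (fderiv ℝ f g v) := by
  -- Unit horizontal vectors are parametrised by their coefficients in the frame X₁, X₂, so the
  -- minimum is taken over the compact set K × U.
  let U : Set (ℝ × ℝ) := {u | u.1 ^ 2 + u.2 ^ 2 = 1}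
  have hU : IsCompact U := by
    refine (isCompact_Icc (a := ((-1, -1) : ℝ × ℝ)) (b := (1, 1))).of_isClosed_subset
      (isClosed_eq (by fun_prop) continuous_const) fun u hu => ?_
    have hu : u.1 ^ 2 + u.2 ^ 2 = 1 := hu
    have h1 := abs_le.1 ((sq_le_one_iff_abs_le_one u.1).1 (by nlinarith [sq_nonneg u.2]))
    have h2 := abs_le.1 ((sq_le_one_iff_abs_le_one u.2).1 (by nlinarith [sq_nonneg u.1]))
    exact ⟨⟨h1.1, h2.1⟩, ⟨h1.2, h2.2⟩⟩
  have hX : Continuous fun x : Heis × (ℝ × ℝ) => x.2.1 • X₁ x.1 + x.2.2 • X₂ x.1 := by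
    refine continuous_pi fun i => ?_
    fin_cases i <;> simp [X₁, X₂] <;> fun_prop
  have hF : Continuous fun x : Heis × (ℝ × ℝ) =>
      horizontalNorm (fderiv ℝ f x.1 (x.2.1 • X₁ x.1 + x.2.2 • X₂ x.1)) :=
    continuous_horizontalNorm.comp ((hf.continuous_fderiv_apply one_ne_zero).comp
      (continuous_fst.prodMk hX))
  have hmem (g : Heis) (s t : ℝ) : s • X₁ g + t • X₂ g ∈ horizontalPlane g :=
    Submodule.mem_span_pair.2 ⟨s, t, rfl⟩
  obtain ⟨⟨g₀, u₀⟩, ⟨-, hu₀⟩, hmin⟩ := (hK.prod hU).exists_isMinOn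
    (hK0.prod ⟨(1, 0), by simp [U]⟩) hF.continuousOn
  refine ⟨_, horizontalNorm_fderiv_pos hcontact hJ (hmem g₀ u₀.1 u₀.2) fun h => ?_,
    fun g hg v hv => ?_⟩
  · have h0 := congrFun h 0
    have h1 := congrFun h 1
    simp [X₁, X₂] at h0 h1
    simp [U, h0, h1] at hu₀
  · rcases (horizontalNorm_nonneg v).eq_or_lt with h0 | h0
    · rw [← h0, mul_zero]; exact horizontalNorm_nonneg _
    · have hu : (v 0 / horizontalNorm v, v 1 / horizontalNorm v) ∈ U := by
        have : horizontalNorm v ^ 2 = v 0 ^ 2 + v 1 ^ 2 := Real.sq_sqrt (by positivity)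
        simp only [U, Set.mem_ofPred_eq, div_pow, ← add_div, ← this]
        exact div_self (by positivity)
      have hle := hmin (Set.mk_mem_prod hg hu)
      have hv' : v = horizontalNorm v •
          ((v 0 / horizontalNorm v) • X₁ g + (v 1 / horizontalNorm v) • X₂ g) := by
        rw [smul_add, smul_smul, smul_smul, mul_div_cancel₀ _ h0.ne', mul_div_cancel₀ _ h0.ne']
        exact eq_of_mem_horizontalPlane hv
      conv_rhs => rw [hv', map_smul, horizontalNorm_smul, abs_of_pos h0]
      rw [mul_comm]
      exact mul_le_mul_of_nonneg_left hle h0.le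

/-- One compact set containing all the curves, so that bounds on it are uniform in θ and α. -/
theorem radialCurve_mem_closedBall {b : ℝ} (θ : ℝ) (α : ℝ) {r : ℝ} (hr : r ∈ Set.Icc 1 b) :
    radialCurve θ α r ∈ Metric.closedBall (0 : Heis) (b ^ 2) := by
  have h0 : 0 < r := zero_lt_one.trans_le hr.1
  have h2 : r ^ 2 ≤ b ^ 2 := pow_le_pow_left₀ h0.le hr.2 2
  have h1 : r ≤ r ^ 2 := by nlinarith [hr.1]
  have hk : √(Real.cos α) ≤ 1 := Real.sqrt_le_one.2 (Real.cos_le_one α)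
  have hk0 := Real.sqrt_nonneg (Real.cos α)
  have key (x : ℝ) (hx : |x| ≤ 1) : |r * √(Real.cos α) * x| ≤ b ^ 2 := by
    rw [abs_mul, abs_mul, abs_of_pos h0, abs_of_nonneg hk0]
    calc r * √(Real.cos α) * |x| ≤ r * 1 * 1 := by gcongr
      _ ≤ b ^ 2 := by linarith
  rw [mem_closedBall_zero_iff, pi_norm_le_iff_of_nonneg (by positivity)]
  intro i
  fin_cases i
  · exact key _ (Real.abs_cos_le_one _)
  · exact key _ (Real.abs_sin_le_one _)
  · change |r ^ 2 * Real.sin α| ≤ b ^ 2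
    rw [abs_mul, abs_of_pos (by positivity)]
    calc r ^ 2 * |Real.sin α| ≤ r ^ 2 * 1 := by gcongr; exact Real.abs_sin_le_one _
      _ ≤ b ^ 2 := by linarith

theorem exists_le_ell (hf : ContDiff ℝ 1 f) (hcontact : IsContact f)
    (hJ : ∀ g, 0 < jacobian f g) {b q : ℝ} (hb : 1 < b) (hq : 0 ≤ q) :
    ∃ c > 0, ∀ θ α, 0 < Real.cos α → c ≤ ell f b q θ α := by
  have hK := isCompact_closedBall (0 : Heis) (b ^ 2)
  have hK0 : (Metric.closedBall (0 : Heis) (b ^ 2)).Nonempty := ⟨0, by simp; positivity⟩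
  obtain ⟨m, hm, hmle⟩ := exists_mul_horizontalNorm_le hf hcontact hJ hK hK0
  obtain ⟨g₁, -, hmin⟩ := hK.exists_isMinOn hK0 (continuous_jacobian hf).continuousOn
  obtain ⟨g₂, -, hmax⟩ := hK.exists_isMaxOn hK0 (continuous_jacobian hf).continuousOn
  have hd := hJ g₁
  have hM := hJ g₂
  set δ := jacobian f g₁
  set M := jacobian f g₂
  have hb0 : 0 < b := zero_lt_one.trans hb
  have hb1 : 0 < b - 1 := sub_pos.2 hb
  -- On [1, b] the speed is at least m and the density lies between δ and M b³, which bounds the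
  -- integrand below; b - 1 is the interval's length.
  refine ⟨(b - 1) * ((m / (M * b ^ 3)) ^ q * δ), by positivity, fun θ α hα => ?_⟩
  have hcont := continuousOn_ell_integrand hf hJ hq b θ α
  have := intervalIntegral.integral_mono_on hb.le
    (intervalIntegrable_const (c := (m / (M * b ^ 3)) ^ q * δ) (μ := volume))
    (hcont.intervalIntegrable_of_Icc hb.le) fun r hr => ?_
  · rwa [intervalIntegral.integral_const, smul_eq_mul] at this
  have hr0 : 0 < r := zero_lt_one.trans_le hr.1
  have hD := imageDensity_pos hJ θ α hr0
  have hg := radialCurve_mem_closedBall θ α hr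
  have hDle : imageDensity f θ α r ≤ M * b ^ 3 :=
    mul_le_mul (hmax hg) (pow_le_pow_left₀ hr0.le hr.2 3) (by positivity) hM.le
  have hDge : δ ≤ imageDensity f θ α r :=
    (hmin hg).trans (le_mul_of_one_le_right (hJ _).le (one_le_pow₀ hr.1))
  have hs : m ≤ imageSpeed f θ α r := by
    rw [imageSpeed_eq hf θ α hr0.ne']
    refine le_trans ?_ (hmle _ hg _ (radialVelocity_mem_horizontalPlane θ r hα))
    refine le_mul_of_one_le_right hm.le ?_
    -- The radial curve has speed (cos α)^(-1/2) ≥ 1; it blows up as α → ±π/2, which does not harm a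
    -- lower bound.
    rw [horizontalNorm, sq_add_sq_radialVelocity θ r hα, Real.one_le_sqrt]
    exact (one_le_inv₀ hα).2 (Real.cos_le_one α)
  have hs0 := imageSpeed_nonneg f θ α r
  gcongr

/-! ### Measurability of ℓ and ρ₀ -/

theorem measurable_radialVelocity :
    Measurable fun z : Heis => radialVelocity (z 0) (z 1) (z 2) := by
  refine measurable_pi_iff.2 fun i => ?_
  fin_cases i <;> simp [radialVelocity, Real.tan_eq_sin_div_cos] <;> fun_prop

/-- The derivative in `imageSpeed` is taken in r with θ, α fixed; the chain rule replaces it by an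
expression jointly measurable in all three. -/
theorem exists_measurable_eq_imageSpeed (hf : ContDiff ℝ 1 f) :
    ∃ S : Heis → ℝ, Measurable S ∧ ∀ z, z 2 ≠ 0 → imageSpeed f (z 0) (z 1) (z 2) = S z :=
  ⟨fun z => horizontalNorm (fderiv ℝ f (polarMap z) (radialVelocity (z 0) (z 1) (z 2))),
    continuous_horizontalNorm.measurable.comp
      ((hf.continuous_fderiv_apply one_ne_zero).measurable.comp
        (measurable_polarMap.prodMk measurable_radialVelocity)),
    fun _ hz => imageSpeed_eq hf _ _ hz⟩

theorem measurable_imageDensity_polar (hf : ContDiff ℝ 1 f) :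
    Measurable fun z : Heis => imageDensity f (z 0) (z 1) (z 2) :=
  ((continuous_jacobian hf).measurable.comp measurable_polarMap).mul
    ((measurable_pi_apply 2).pow_const 3)

theorem measurable_ell (hf : ContDiff ℝ 1 f) {b : ℝ} (hb : 1 ≤ b) (q : ℝ) :
    Measurable fun z : Heis => ell f b q (z 0) (z 1) := by
  obtain ⟨S, hS, hSeq⟩ := exists_measurable_eq_imageSpeed hf
  have hD := measurable_imageDensity_polar hf
  have hK : Measurable fun z : Heis =>
      (S z / imageDensity f (z 0) (z 1) (z 2)) ^ q * imageDensity f (z 0) (z 1) (z 2) :=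
    ((hS.div hD).pow_const q).mul hD
  have hι : Measurable fun x : Heis × ℝ => (![x.1 0, x.1 1, x.2] : Heis) := by
    refine measurable_pi_iff.2 fun i => ?_
    fin_cases i <;> simp <;> fun_prop
  have := (StronglyMeasurable.integral_prod_right (ν := volume.restrict (Set.Ioc 1 b))
    (f := fun (z : Heis) r => (S ![z 0, z 1, r] / imageDensity f (z 0) (z 1) r) ^ q *
      imageDensity f (z 0) (z 1) r) (hK.comp hι).stronglyMeasurable).measurable
  convert this using 2 with z
  rw [ell, intervalIntegral.integral_of_le hb]
  refine setIntegral_congr_fun measurableSet_Ioc fun r hr => ?_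
  have := hSeq ![z 0, z 1, r] (zero_lt_one.trans hr.1).ne'
  simp only [Matrix.cons_val] at this
  simp only [this]

theorem injective_polarDomain {b : ℝ} (hinj : Set.InjOn f (sphericalRing b)) :
    Function.Injective fun z : polarDomain b => f (radialCurve z.1.1 z.1.2.1 z.1.2.2) := by
  intro z w h
  have := injOn_comp_polarMap hinj (mem_polarBox.2 z.2 :
    (![z.1.1, z.1.2.1, z.1.2.2] : Heis) ∈ polarBox b)
    (mem_polarBox.2 w.2 : (![w.1.1, w.1.2.1, w.1.2.2] : Heis) ∈ polarBox b) h
  exact Subtype.ext (Prod.ext (congrFun this 0) (Prod.ext (congrFun this 1) (congrFun this 2)))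

/-- By Lusin–Souslin, an injective Borel map on a standard Borel space is a measurable embedding, so
extension by 0 from its image preserves measurability. -/
theorem measurable_extremalFunction (hf : ContDiff ℝ 1 f) {b : ℝ} (hb : 1 ≤ b)
    (hinj : Set.InjOn f (sphericalRing b)) (p q : ℝ) :
    Measurable (extremalFunction f b p q) := by
  obtain ⟨S, hS, hSeq⟩ := exists_measurable_eq_imageSpeed hf
  have hD := measurable_imageDensity_polar hf
  have hι : Measurable fun z : polarDomain b => (![z.1.1, z.1.2.1, z.1.2.2] : Heis) := by
    refine measurable_pi_iff.2 fun i => ?_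
    fin_cases i <;> simp <;> fun_prop
  have hdom : MeasurableSet (polarDomain b) :=
    measurableSet_Ico.prod (measurableSet_Ioo.prod measurableSet_Icc)
  have := hdom.standardBorel
  have hemb : MeasurableEmbedding
      fun z : polarDomain b => f (radialCurve z.1.1 z.1.2.1 z.1.2.2) :=
    ((measurable_comp_polarMap hf).comp hι).measurableEmbedding (injective_polarDomain hinj)
  refine hemb.measurable_extend ?_ measurable_const
  · have hF := ((measurable_ell hf hb q).inv.mul
      ((hS.div hD).pow_const (1 / (p - 1)))).ennreal_ofReal
    convert hF.comp hι using 2 with z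
    have := hSeq ![z.1.1, z.1.2.1, z.1.2.2] (zero_lt_one.trans_le z.2.2.2.1).ne'
    simp only [Matrix.cons_val] at this
    simp [this]

theorem extremalFunction_apply {b : ℝ} (hinj : Set.InjOn f (sphericalRing b)) (p q : ℝ)
    {θ α r : ℝ} (hz : (θ, α, r) ∈ polarDomain b) :
    extremalFunction f b p q (f (radialCurve θ α r)) = ENNReal.ofReal ((ell f b q θ α)⁻¹ *
      (imageSpeed f θ α r / imageDensity f θ α r) ^ (1 / (p - 1))) :=
  (injective_polarDomain hinj).extend_apply _ _ ⟨(θ, α, r), hz⟩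

theorem extremalFunction_eq_zero (f : Heis → Heis) {b : ℝ} (p q : ℝ) {y : Heis}
    (hy : y ∉ (fun z => f (polarMap z)) '' polarBox b) : extremalFunction f b p q y = 0 := by
  refine Function.extend_apply' _ _ _ ?_
  rintro ⟨z, rfl⟩
  exact hy ⟨![z.1.1, z.1.2.1, z.1.2.2], mem_polarBox.2 z.2, rfl⟩

/-! ### Estimates on a single curve -/

/-- The lower bound for the mass of an admissible function on a single curve. -/
theorem ofReal_ell_rpow_le (hf : ContDiff ℝ 1 f) (hJ : ∀ g, 0 < jacobian f g)
    {b p q : ℝ} (hb : 1 ≤ b) (h : p.HolderConjugate q) {θ α : ℝ} (hell : 0 < ell f b q θ α)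
    {ρ : Heis → ℝ≥0∞} (hρ : Measurable ρ)
    (h1 : 1 ≤ arcIntegral 1 b ρ fun r => f (radialCurve θ α r)) :
    ENNReal.ofReal (ell f b q θ α ^ (1 - p)) ≤ ∫⁻ r in Set.Icc 1 b,
      ρ (f (radialCurve θ α r)) ^ p * ENNReal.ofReal (imageDensity f θ α r) := by
  have hD := measurable_imageDensity hf θ α
  have hw : Measurable fun r => imageSpeed f θ α r / imageDensity f θ α r :=
    (measurable_imageSpeed f θ α).div hD
  -- Hölder with u = ρ ∘ c, w = speed / density and d = density, so that u w d is the arc length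
  -- integrand.
  have key := one_le_of_one_le_lintegral_mul (μ := volume.restrict (Set.Icc 1 b)) h
    (hρ.comp (hf.continuous.measurable.comp (measurable_radialCurve θ α)))
    hw.ennreal_ofReal hD.ennreal_ofReal (h1.trans_eq ?_)
  · rw [← ofReal_ell hf hJ hb h.symm.nonneg, ENNReal.ofReal_rpow_of_pos hell] at key
    have hpos : 0 < ell f b q θ α ^ (p - 1) := Real.rpow_pos_of_pos hell _
    rw [← neg_sub, Real.rpow_neg hell.le, ENNReal.ofReal_inv_of_pos hpos,
      ENNReal.inv_le_iff_le_mul (fun _ => by simpa using hpos)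
        (fun h => absurd h ENNReal.ofReal_ne_top), mul_comm]
    exact key
  · refine setLIntegral_congr_fun measurableSet_Icc fun r hr => ?_
    have hd := imageDensity_pos hJ θ α (zero_lt_one.trans_le hr.1)
    simp only [Function.comp]
    rw [mul_assoc, ← ENNReal.ofReal_mul (div_nonneg (imageSpeed_nonneg f θ α r) hd.le),
      div_mul_cancel₀ _ hd.ne']
    rfl

theorem arcIntegral_extremalFunction (hf : ContDiff ℝ 1 f) (hJ : ∀ g, 0 < jacobian f g)
    {b p q : ℝ} (hb : 1 ≤ b) (h : p.HolderConjugate q) (hinj : Set.InjOn f (sphericalRing b))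
    {θ α : ℝ} (hθ : θ ∈ Set.Ico 0 (2 * Real.pi)) (hα : α ∈ Set.Ioo (-(Real.pi / 2)) (Real.pi / 2))
    (hell : 0 < ell f b q θ α) :
    arcIntegral 1 b (extremalFunction f b p q) (fun r => f (radialCurve θ α r)) = 1 := by
  have : arcIntegral 1 b (extremalFunction f b p q) (fun r => f (radialCurve θ α r)) =
      ∫⁻ r in Set.Icc 1 b, ENNReal.ofReal (ell f b q θ α)⁻¹ *
        (ENNReal.ofReal (imageSpeed f θ α r / imageDensity f θ α r) ^ q *
        ENNReal.ofReal (imageDensity f θ α r)) := by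
    refine setLIntegral_congr_fun measurableSet_Icc fun r hr => ?_
    have hd := imageDensity_pos hJ θ α (zero_lt_one.trans_le hr.1)
    have hw := div_nonneg (imageSpeed_nonneg f θ α r) hd.le
    have hs : horizontalNorm (deriv (fun r => f (radialCurve θ α r)) r) =
        imageSpeed f θ α r / imageDensity f θ α r * imageDensity f θ α r :=
      (div_mul_cancel₀ _ hd.ne').symm
    have hq : 1 / (p - 1) + 1 = q := by
      have := h.sub_one_ne_zero
      rw [h.conjugate_eq]; field_simp; ring
    simp only
    rw [extremalFunction_apply hinj p q ⟨hθ, hα, hr⟩, hs,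
      ENNReal.ofReal_rpow_of_nonneg hw h.symm.nonneg,
      ← ENNReal.ofReal_mul (by positivity), ← ENNReal.ofReal_mul (by positivity),
      ← ENNReal.ofReal_mul (by positivity), ← hq,
      Real.rpow_add_one' hw (by rw [hq]; exact h.symm.ne_zero)]
    congr 1
    ring
  rw [this, lintegral_const_mul' _ _ ENNReal.ofReal_ne_top, ← ofReal_ell hf hJ hb h.symm.nonneg,
    ← ENNReal.ofReal_mul (by positivity), inv_mul_cancel₀ hell.ne', ENNReal.ofReal_one]

theorem lintegral_radialCurve_extremalFunction (hf : ContDiff ℝ 1 f)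
    (hJ : ∀ g, 0 < jacobian f g)
    {b p q : ℝ} (hb : 1 ≤ b) (h : p.HolderConjugate q) (hinj : Set.InjOn f (sphericalRing b))
    {θ α : ℝ} (hθ : θ ∈ Set.Ico 0 (2 * Real.pi)) (hα : α ∈ Set.Ioo (-(Real.pi / 2)) (Real.pi / 2))
    (hell : 0 < ell f b q θ α) :
    ∫⁻ r in Set.Icc 1 b, extremalFunction f b p q (f (radialCurve θ α r)) ^ p *
      ENNReal.ofReal (imageDensity f θ α r) = ENNReal.ofReal (ell f b q θ α ^ (1 - p)) := by
  have : ∫⁻ r in Set.Icc 1 b, extremalFunction f b p q (f (radialCurve θ α r)) ^ p *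
      ENNReal.ofReal (imageDensity f θ α r) =
      ∫⁻ r in Set.Icc 1 b, ENNReal.ofReal ((ell f b q θ α)⁻¹ ^ p) *
        (ENNReal.ofReal (imageSpeed f θ α r / imageDensity f θ α r) ^ q *
        ENNReal.ofReal (imageDensity f θ α r)) := by
    refine setLIntegral_congr_fun measurableSet_Icc fun r hr => ?_
    have hd := imageDensity_pos hJ θ α (zero_lt_one.trans_le hr.1)
    have hw := div_nonneg (imageSpeed_nonneg f θ α r) hd.le
    have hq : 1 / (p - 1) * p = q := by rw [h.conjugate_eq]; ring
    rw [extremalFunction_apply hinj p q ⟨hθ, hα, hr⟩,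
      ENNReal.ofReal_rpow_of_nonneg hw h.symm.nonneg,
      ENNReal.ofReal_rpow_of_nonneg (by positivity) h.nonneg,
      Real.mul_rpow (by positivity) (by positivity), ← Real.rpow_mul hw, hq,
      ENNReal.ofReal_mul (by positivity), mul_assoc]
  rw [this, lintegral_const_mul' _ _ ENNReal.ofReal_ne_top, ← ofReal_ell hf hJ hb h.symm.nonneg,
    ← ENNReal.ofReal_mul (by positivity), Real.inv_rpow hell.le, ← Real.rpow_neg hell.le,
    ← Real.rpow_add_one hell.ne']
  congr 2
  ring

end
end Heis

/-! ### Integration over the family of curves -/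

theorem mainTheorem6 (p q b : ℝ) (hp : 1 < p) (hq : 1 < q) (hpq : 1 / p + 1 / q = 1)
    (hb : 1 < b) (f : Heis → Heis) (hf : ContDiff ℝ 1 f) (hcontact : Heis.IsContact f)
    (horient : ∀ g : Heis, 0 < Heis.jacobian f g)
    (hinj : Set.InjOn f (Heis.sphericalRing b)) :
    Heis.IsExtremal 1 b p (Heis.imageFamily f Heis.radialFamily)
      (Heis.extremalFunction f b p q) ∧
    Heis.pModule 1 b p (Heis.imageFamily f Heis.radialFamily) =
      ∫⁻ y in f '' Heis.sphericalRing b, Heis.extremalFunction f b p q y ^ p ∧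
    Heis.pModule 1 b p (Heis.imageFamily f Heis.radialFamily) =
      ∫⁻ α in Set.Ioo (-(Real.pi / 2)) (Real.pi / 2), ∫⁻ θ in Set.Ico 0 (2 * Real.pi),
        ENNReal.ofReal (Heis.ell f b q θ α ^ (1 - p)) ∧
    Heis.pModule 1 b p (Heis.imageFamily f Heis.radialFamily) ≠ ⊤ := by
  open Heis in
  have h : p.HolderConjugate q := Real.holderConjugate_iff.2 ⟨hp, by simpa using hpq⟩
  obtain ⟨c, hc, hcle⟩ := exists_le_ell hf hcontact horient hb h.symm.nonneg
  have hell (θ : ℝ) {α : ℝ} (hα : α ∈ Set.Ioo (-(Real.pi / 2)) (Real.pi / 2)) :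
      0 < ell f b q θ α := hc.trans_le (hcle θ α (Real.cos_pos_of_mem_Ioo hα))
  have hmeas := measurable_extremalFunction hf hb.le hinj p q
  have hadm : IsAdmissible 1 b (imageFamily f radialFamily) (extremalFunction f b p q) := by
    refine ⟨hmeas, ?_⟩
    rintro _ ⟨_, ⟨θ, hθ, α, hα, rfl⟩, rfl⟩
    exact (arcIntegral_extremalFunction hf horient hb.le h hinj hθ hα (hell θ hα)).ge
  set I := ∫⁻ α in Set.Ioo (-(Real.pi / 2)) (Real.pi / 2), ∫⁻ θ in Set.Ico 0 (2 * Real.pi),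
        ENNReal.ofReal (ell f b q θ α ^ (1 - p)) with hI
  set s := (fun z => f (polarMap z)) '' polarBox b with hs
  have hsmeas : MeasurableSet s := (measurableSet_polarBox b).image_of_measurable_injOn
    (measurable_comp_polarMap hf) (injOn_comp_polarMap hinj)
  have hmass : ∫⁻ y in s, extremalFunction f b p q y ^ p = I := by
    rw [hs, lintegral_image_polarBox hf horient hinj (hmeas.pow_const p)]
    exact setLIntegral_congr_fun measurableSet_Ioo fun α hα =>
      setLIntegral_congr_fun measurableSet_Ico fun θ hθ =>
        lintegral_radialCurve_extremalFunction hf horient hb.le h hinj hθ hα (hell θ hα)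
  have htotal : ∫⁻ y, extremalFunction f b p q y ^ p = I := by
    rw [← hmass, ← lintegral_indicator hsmeas]
    refine lintegral_congr fun y => ?_
    by_cases hy : y ∈ s
    · rw [Set.indicator_of_mem hy]
    · rw [Set.indicator_of_notMem hy, extremalFunction_eq_zero f p q hy,
        ENNReal.zero_rpow_of_pos h.pos]
  -- It suffices that `s` lies in the image of the ring and already carries the whole integral; that
  -- polar coordinates cover the ring up to a null set is not needed.
  have hring : ∫⁻ y in f '' sphericalRing b, extremalFunction f b p q y ^ p = I := by
    refine le_antisymm (htotal ▸ setLIntegral_le_lintegral _ _) (hmass ▸ lintegral_mono_set ?_)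
    rintro _ ⟨z, hz, rfl⟩
    exact ⟨_, polarMap_mem_sphericalRing hz, rfl⟩
  have hmod : pModule 1 b p (imageFamily f radialFamily) = I := by
    refine le_antisymm (htotal ▸ iInf₂_le _ hadm) (le_iInf₂ fun ρ hρ => ?_)
    calc I ≤ ∫⁻ y in s, ρ y ^ p := ?_
      _ ≤ ∫⁻ y, ρ y ^ p := setLIntegral_le_lintegral _ _
    rw [hs, lintegral_image_polarBox hf horient hinj (hρ.1.pow_const p)]
    exact setLIntegral_mono' measurableSet_Ioo fun α hα =>
      setLIntegral_mono' measurableSet_Ico fun θ hθ =>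
        ofReal_ell_rpow_le hf horient hb.le h (hell θ hα) hρ.1
          (hρ.2 _ ⟨_, ⟨θ, hθ, α, hα, rfl⟩, rfl⟩)
  -- Since 1 - p < 0, the lower bound c for ℓ bounds ℓ^(1-p) above, on a parameter rectangle of
  -- finite area.
  have hfin : I < ⊤ := by
    have hle : I ≤ ∫⁻ _ in Set.Ioo (-(Real.pi / 2)) (Real.pi / 2),
        ∫⁻ _ in Set.Ico 0 (2 * Real.pi), ENNReal.ofReal (c ^ (1 - p)) :=
      setLIntegral_mono' measurableSet_Ioo fun α hα => lintegral_mono fun θ =>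
        ENNReal.ofReal_le_ofReal (Real.rpow_le_rpow_of_nonpos hc
          (hcle θ α (Real.cos_pos_of_mem_Ioo hα)) (by linarith))
    refine hle.trans_lt ?_
    simp only [lintegral_const, Measure.restrict_apply_univ, Real.volume_Ioo, Real.volume_Ico]
    finiteness
  exact ⟨⟨hadm, hmod.trans htotal.symm⟩, hmod.trans hring.symm, hmod, hmod ▸ hfin.ne⟩
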